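/- Let $p>3$ be a prime, $R=\mathbb Z_p[[t]]$, let $\sigma:R\to R$ be the Frobenius lift $g(t)\mapsto g(t^p)$, and let $f=x^3-x-t$, $f^\sigma=x^3-x-t^p$. Expand rational functions and differential forms in powers of $1/x$. For $h\in\{f,f^\sigma\}$ let $\mathcal O_h$ be the $R$-module generated by the functions $l!\,x^k/h^{l+1}$ with $l\ge 0$, $0\le k\le 3(l+1)-1$, let $\hat{\mathcal O}_h=\varprojlim_s \mathcal O_h/p^s\mathcal O_h$ be its $p$-adic completion (regarded inside $R[[1/x]]$), and let $d\hat{\mathcal O}_h$ be the module of differentials $dg$, $g\in\hat{\mathcal O}_h$. Let $\mathscr C$ be the Cartier operator $\sum_n a_n x^{-n}\frac{dx}{x}\mapsto\sum_n a_{pn}x^{-n}\frac{dx}{x}$. Write $F(a,b,c\,|\,z)=\sum_{n\ge0}\frac{(a)_n(b)_n}{(c)_n\,n!}z^n$ and $$Y(t)=\begin{pmatrix}F(\frac13,\frac23,\frac12\,|\,\frac{27t^2}4)&-\frac32\,t\,F(\frac76,\frac56,\frac32\,|\,\frac{27t^2}4)\\[2pt] -t\,F(\frac23,\frac43,\frac32\,|\,\frac{27t^2}4)&F(\frac16,\frac56,\frac12\,|\,\frac{27t^2}4)\end{pmatrix}.$$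 (1) $Y(t)$ is the matrix of residue periods $$Y(t)=\begin{pmatrix}\rho_0(dx/f)&\rho_\pm(dx/f)\\ \rho_0(x\,dx/f)&\rho_\pm(x\,dx/f)\end{pmatrix},$$ where, for $k=0,1$, $\mathrm{res}_{x=a}(x^k dx/f):=\sum_{r\ge0}t^r\,\mathrm{res}_{x=a}\frac{x^k dx}{(x^3-x)^{r+1}}$, and $\rho_0=-\mathrm{res}_{x=0}$, $\rho_\pm=\mathrm{res}_{x=1}-\mathrm{res}_{x=-1}$. (2) $Y(t)$ has entries in $R$ and $Y(t^p)$ is invertible over $R$. There is exactly one $2\times2$ matrix $\Lambda_p$ with entries in $R$ such that $$\mathscr C\begin{pmatrix}dx/f\\ x\,dx/f\end{pmatrix}\equiv\Lambda_p\begin{pmatrix}dx/f^\sigma\\ x\,dx/f^\sigma\end{pmatrix}\pmod{d\hat{\mathcal O}_{f^\sigma}},$$ namely $$\Lambda_p=Y(t)\,Y(t^p)^{-1}.$$ -/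

import Mathlib

noncomputable section

namespace CartierCubic

/-! ### Differential forms expanded at infinity

Let `R` be a commutative ring.  With `u = 1/x`, a power series `∑ aₙ uⁿ` in `PowerSeries R` stands
either for the function `∑ aₙ x⁻ⁿ`, or for the differential form `∑ aₙ x⁻ⁿ dx/x`. -/

section Formal

variable {R : Type*} [CommRing R]

/-- The expansion in powers of `u = 1/x` of the rational function `x ^ k / f ^ (l + 1)`,
for `f` monic and `k ≤ (deg f) * (l + 1)`. See `expansion_mul` for the defining property. -/
def expansion (f : Polynomial R) (k l : ℕ) : PowerSeries R :=
  PowerSeries.X ^ (f.natDegree * (l + 1) - k) *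
    PowerSeries.invOfUnit (f.reverse : PowerSeries R) 1 ^ (l + 1)

/-- In the ring of Laurent series in `u`, with `x = u⁻¹`, one has
`expansion f k l * f(x) ^ (l + 1) = x ^ k`. -/
theorem expansion_mul (f : Polynomial R) (hf : f.Monic) (k l : ℕ)
    (hk : k ≤ f.natDegree * (l + 1)) :
    HahnSeries.ofPowerSeries ℤ R (expansion f k l) *
      (Polynomial.eval₂ HahnSeries.C (HahnSeries.single (-1 : ℤ) (1 : R)) f) ^ (l + 1) =
      HahnSeries.single (-1 : ℤ) (1 : R) ^ k := by
  set x : LaurentSeries R := HahnSeries.single (-1 : ℤ) (1 : R) with hx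
  set u : LaurentSeries R := HahnSeries.single (1 : ℤ) (1 : R) with hu
  have hux : u * x = 1 := by simp [hx, hu]
  have hxu : x * u = 1 := by rw [mul_comm, hux]
  let i : Invertible x := ⟨u, hux, hxu⟩
  have hX : HahnSeries.ofPowerSeries ℤ R PowerSeries.X = u := by simp [hu]
  have hrev : HahnSeries.ofPowerSeries ℤ R (f.reverse : PowerSeries R) =
      Polynomial.eval₂ HahnSeries.C u f.reverse := by
    have h : ∀ g : Polynomial R, HahnSeries.ofPowerSeries ℤ R (g : PowerSeries R) =
        Polynomial.eval₂ HahnSeries.C u g := by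
      intro g
      induction g using Polynomial.induction_on' with
      | add a b ha hb => simp [ha, hb, Polynomial.eval₂_add]
      | monomial n a =>
        rw [← Polynomial.C_mul_X_pow_eq_monomial]
        simp [hX, Polynomial.eval₂_mul]
    exact h _
  have hf1 : Polynomial.eval₂ HahnSeries.C u f.reverse * x ^ f.natDegree =
      Polynomial.eval₂ HahnSeries.C x f := Polynomial.eval₂_reverse_mul_pow _ x f
  have hinv : (f.reverse : PowerSeries R) * PowerSeries.invOfUnit (f.reverse : PowerSeries R) 1
      = 1 := by
    apply PowerSeries.mul_invOfUnit
    simp [Polynomial.coeff_zero_reverse, hf.leadingCoeff]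
  have hinv' := congrArg (HahnSeries.ofPowerSeries ℤ R) hinv
  rw [map_mul, map_one, hrev] at hinv'
  rw [← hf1, expansion, map_mul, map_pow, map_pow, hX]
  obtain ⟨m, hm⟩ := Nat.exists_eq_add_of_le hk
  rw [mul_pow, ← pow_mul, hm, Nat.add_sub_cancel_left, pow_add x]
  calc _ = (u * x) ^ m * (Polynomial.eval₂ HahnSeries.C u f.reverse *
      HahnSeries.ofPowerSeries ℤ R
        (PowerSeries.invOfUnit (f.reverse : PowerSeries R) 1)) ^ (l + 1) * x ^ k := by ring
    _ = x ^ k := by rw [hux, hinv']; simp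

/-- The `R`-module `𝒪_f` generated by the functions `l! x ^ k / f ^ (l + 1)` with
`0 ≤ k ≤ d (l + 1) - 1`, where `d = deg f`, embedded in the formal series by expansion at
infinity. -/
def functions (f : Polynomial R) : Submodule R (PowerSeries R) :=
  Submodule.span R {g | ∃ k l : ℕ, k < f.natDegree * (l + 1) ∧
    g = (l.factorial : R) • expansion f k l}

/-- The `p`-adic completion `lim M / p ^ s M` of a module `M` of formal series, viewed inside
the module of formal series: `g` belongs to it when some element of the completion of `M` has
image `g` in the completion of the module of all formal series. -/
def completion (p : ℕ) (M : Submodule R (PowerSeries R)) : Submodule R (PowerSeries R) :=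
  ((LinearMap.range (AdicCompletion.map (Ideal.span {(p : R)}) M.subtype)).restrictScalars R).comap
    (AdicCompletion.of (Ideal.span {(p : R)}) (PowerSeries R))

/-- Exterior derivative: `d (∑ aₙ x⁻ⁿ) = ∑ (-n aₙ) x⁻ⁿ dx/x`. -/
def diff : PowerSeries R →ₗ[R] PowerSeries R where
  toFun g := PowerSeries.mk fun n => -(n : R) * PowerSeries.coeff n g
  map_add' g h := by ext n; simp [mul_add]
  map_smul' r g := by ext n; simp; ring

/-- The Cartier operator `∑ aₙ x⁻ⁿ dx/x ↦ ∑ a_{pn} x⁻ⁿ dx/x`. -/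
def cartier (p : ℕ) : PowerSeries R →ₗ[R] PowerSeries R where
  toFun g := PowerSeries.mk fun n => PowerSeries.coeff (p * n) g
  map_add' g h := by ext n; simp
  map_smul' r g := by ext n; simp

/-- The forms `dx / f` (for `i = 0`) and `x dx / f` (for `i = 1`), that is
`x ^ (i + 1) / f · dx / x`. -/
def basisForm (f : Polynomial R) (i : Fin 2) : PowerSeries R :=
  expansion f ((i : ℕ) + 1) 0

/-- `Λ` is a matrix of the Cartier operator on `dx / f`, `x dx / f`, for the Frobenius lift `σ`:
`𝒞 (ω_i) ≡ ∑ j, Λ i j ω_j^σ` modulo the exact forms `d 𝒪̂`, where `ω_j^σ` are the forms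
`dx / f^σ`, `x dx / f^σ` and `𝒪̂` is the `p`-adic completion of `𝒪_{f^σ}`. -/
def IsCartierMatrix (p : ℕ) (σ : R →+* R) (f : Polynomial R)
    (Λ : Matrix (Fin 2) (Fin 2) R) : Prop :=
  ∀ i, cartier p (basisForm f i) - ∑ j, Λ i j • basisForm (f.map σ) j ∈
    (completion p (functions (f.map σ))).map diff

end Formal

/-! ### The cubic `x³ - x - t` over `ℤ_p⟦t⟧` -/

/-- The Frobenius lift `g(t) ↦ g(t ^ p)` on `ℤ_p⟦t⟧`. -/
def frob (p : ℕ) [hp : Fact p.Prime] : PowerSeries ℤ_[p] →+* PowerSeries ℤ_[p] :=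
  (PowerSeries.expand p hp.out.ne_zero : PowerSeries ℤ_[p] →ₐ[ℤ_[p]] PowerSeries ℤ_[p])

/-- The polynomial `x³ - x - t` with coefficients in `ℤ_p⟦t⟧`. -/
def cubic (p : ℕ) [Fact p.Prime] : Polynomial (PowerSeries ℤ_[p]) :=
  Polynomial.X ^ 3 - Polynomial.X - Polynomial.C PowerSeries.X

/-! ### Residue periods -/

/-- The residue at `x = a` of `x ^ k dx / (x³ - x) ^ (r + 1)`: the coefficient of `y⁻¹` in the
Laurent expansion in `y = x - a`. -/
def residue (a : ℚ) (k r : ℕ) : ℚ :=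
  let x : LaurentSeries ℚ := HahnSeries.C a + HahnSeries.single (1 : ℤ) (1 : ℚ)
  (x ^ k / (x ^ 3 - x) ^ (r + 1)).coeff (-1)

/-- The termwise residue at `x = a` of
`x ^ k dx / (x³ - x - t) = ∑ r, t ^ r x ^ k dx / (x³ - x) ^ (r + 1)`. -/
def period (a : ℚ) (k : ℕ) : PowerSeries ℚ :=
  PowerSeries.mk fun r => residue a k r

/-- Rows: `dx / f`, `x dx / f`. Columns: minus the residue at `0`, and the residue at `1` minus
the residue at `-1`. -/
def periodMatrix : Matrix (Fin 2) (Fin 2) (PowerSeries ℚ) :=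
  !![-period 0 0, period 1 0 - period (-1) 0;
     -period 0 1, period 1 1 - period (-1) 1]

/-! ### Hypergeometric series -/

/-- The series `₂F₁(a, b; c | 27 t² / 4)` in `ℚ⟦t⟧`. -/
def hyp (a b c : ℚ) : PowerSeries ℚ :=
  (PowerSeries.mk (ordinaryHypergeometricCoefficient a b c)).subst
    (PowerSeries.C (27 / 4 : ℚ) * PowerSeries.X ^ 2)

/-- The matrix `Y(t)`. -/
def hypMatrix : Matrix (Fin 2) (Fin 2) (PowerSeries ℚ) :=
  !![hyp (1 / 3) (2 / 3) (1 / 2),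
      -(PowerSeries.C (3 / 2 : ℚ) * PowerSeries.X * hyp (7 / 6) (5 / 6) (3 / 2));
     -(PowerSeries.X * hyp (2 / 3) (4 / 3) (3 / 2)),
      hyp (1 / 6) (5 / 6) (1 / 2)]

end CartierCubic

end

/-! The cubic splits over `R`: modulo `t` it is `x³ - x`, with simple roots 0, 1, -1 because 2 is a
unit, and Hensel lifts these to roots `α i` (`exists_roots`). Partial fractions give `dx/f = ∑ α i'
dx/(x - α i)`, since differentiating `α³ - α = t` shows `α' = 1/f'(α)`.

The Cartier operator sends `dx/(x - α)` to `dx/(x - α^p)`, and `α^p = σ(α) + pδ`. The difference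
from `dx/(x - σ(α))` is `d log(1 - pδ/(x - σ(α)))`. The logarithm is a `p`-adically convergent
series in the `(m-1)!/(x - σ(α))^m` with divided powers `p^m/m!` as coefficients, so it lies in the
completed module (`geom_sub_geom_mem`). Thus `𝒞` carries a basis of logarithmic forms to its
Frobenius twist modulo exact forms. If `Y` expresses `dx/f`, `x dx/f` in that basis, the Cartier
matrix is `Y σ(Y)⁻¹` (`isCartierMatrix_iff`).

Uniqueness: in an exact form the coefficient at `x^(-n)` is divisible by `n`. Testing `n = p^s` and
`n = 2p^s` makes the coefficients of an exact combination divisible by every `p^s`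
(`eq_zero_of_dualForm_exact`).

Identifying `Y`: root residues, formal residues and hypergeometric entries all solve one first-order
system (`IsPeriodPair`), whose solutions are determined by their values at `t = 0`. -/

noncomputable section

namespace CartierCubic

open PowerSeries

/-! ### Logarithmic forms with congruent poles -/

section General

variable {R : Type*} [CommRing R]

/-- A `p`-adic limit of elements of `M` lies in the completion of `M`. -/
theorem mem_completion_of_cauchy {p : ℕ} {M : Submodule R R⟦X⟧} {g : R⟦X⟧} (S : ℕ → M)
    (hS : ∀ n, ∃ e : M, S (n + 1) - S n = (p : R) ^ n • e)
    (hg : ∀ n, ∃ w : R⟦X⟧, g - S n = (p : R) ^ n • w) : g ∈ completion p M := by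
  have hmem : ∀ n, (p : R) ^ n ∈ Ideal.span {(p : R)} ^ n := fun n =>
    Ideal.pow_mem_pow (Ideal.mem_span_singleton_self _) n
  have hS' : ∀ n, S n ≡ S (n + 1)
      [SMOD (Ideal.span {(p : R)} ^ n • ⊤ : Submodule R M)] := by
    intro n
    obtain ⟨e, he⟩ := hS n
    refine SModEq.symm (SModEq.sub_mem.mpr ?_)
    rw [he]
    exact Submodule.smul_mem_smul (hmem n) Submodule.mem_top
  refine ⟨AdicCompletion.mk _ _ (AdicCompletion.AdicCauchySequence.mk _ _ S hS'), ?_⟩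
  rw [AdicCompletion.map_mk]
  refine AdicCompletion.ext fun n => ?_
  obtain ⟨w, hw⟩ := hg n
  symm
  refine (SModEq.sub_mem (U := (Ideal.span {(p : R)} ^ n • ⊤ : Submodule R R⟦X⟧))).mpr ?_
  change g - (S n : R⟦X⟧) ∈ _
  rw [hw]
  exact Submodule.smul_mem_smul (hmem n) Submodule.mem_top

/-- The expansion of `dx / (x - β)`. -/
def geom (β : R) : R⟦X⟧ := PowerSeries.mk fun n => β ^ n

@[simp] theorem coeff_geom (β : R) (n : ℕ) : coeff n (geom β) = β ^ n := coeff_mk _ _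

theorem geom_eq_rescale (β : R) : geom β = rescale β (PowerSeries.mk 1) := by
  ext n; simp

theorem geom_mul (β : R) : geom β * (1 - C β * X) = 1 := by
  have h := congrArg (rescale β) (mk_one_mul_one_sub_eq_one R)
  simpa [geom_eq_rescale, rescale_X] using h

/-- `X * geom β` is the expansion of the function `1/(x - β)`, so this is the negative binomial
series of `(x - β)^(-m-1)`. -/
theorem coeff_succ_X_mul_geom_pow (β : R) (m n : ℕ) :
    coeff (n + 1) (X ^ (m + 1) * geom β ^ (m + 1)) = n.choose m * β ^ (n - m) := by
  rw [coeff_X_pow_mul', geom_eq_rescale, ← map_pow, mk_one_pow_eq_mk_choose_add]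
  split_ifs with h
  · rw [coeff_rescale, coeff_mk, show m + (n + 1 - (m + 1)) = n by omega,
      show n + 1 - (m + 1) = n - m by omega, mul_comm]
  · rw [Nat.choose_eq_zero_of_lt (by omega)]; simp

theorem cartier_geom (p : ℕ) (β : R) : cartier p (geom β) = geom (β ^ p) := by
  ext n; simp [cartier, pow_mul]

/-- `dx / (x - β - p δ) - dx / (x - β)` is the differential of the `p`-adic limit
`-∑ m, (p ^ m / m!) δ ^ m (m - 1)! / (x - β) ^ m`. -/
theorem geom_sub_geom_mem {p : ℕ} {M : Submodule R R⟦X⟧} {β δ : R} {b : ℕ → R}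
    (hb : ∀ m, (m.factorial : R) * b m = (p : R) ^ m) (hdvd : ∀ m, (p : R) ^ (m / 2) ∣ b m)
    (hM : ∀ m : ℕ, (m.factorial : R) • (X ^ (m + 1) * geom β ^ (m + 1)) ∈ M) :
    geom (β + p * δ) - geom β ∈ (completion p M).map diff := by
  set E : ℕ → R⟦X⟧ := fun m => (m.factorial : R) • (X ^ (m + 1) * geom β ^ (m + 1)) with hE
  set a : ℕ → R := fun m => b (m + 1) * δ ^ (m + 1) with ha
  have hE0 : ∀ n m, n ≤ m → coeff n (E m) = 0 := by
    intro n m h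
    simp only [hE, coeff_smul, coeff_X_pow_mul', smul_eq_mul]
    rw [if_neg (by omega), mul_zero]
  have hadvd : ∀ N m, 2 * N ≤ m + 1 → (p : R) ^ N ∣ a m := fun N m h =>
    (((pow_dvd_pow _ (by omega)).trans (hdvd (m + 1)))).mul_right _
  have hsum : ∀ n K, n ≤ K → ∑ m ∈ Finset.range K, a m * coeff n (E m) =
      ∑ m ∈ Finset.range n, a m * coeff n (E m) := by
    intro n K h
    symm
    refine Finset.sum_subset (by simpa using h) fun m _ hm => ?_
    rw [hE0 n m (by simpa using hm), mul_zero]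
  -- Since `p^(m/2)` divides `b m`, two further terms of the logarithm gain one power of `p`; hence
  -- truncation at `2 * N`.
  let S : ℕ → M := fun N => -∑ m ∈ Finset.range (2 * N), a m • (⟨E m, hM m⟩ : M)
  -- The term `E m` starts at `u^(m+1)`, so each coefficient of the infinite sum is a finite one.
  refine ⟨PowerSeries.mk fun n => -∑ m ∈ Finset.range n, a m * coeff n (E m),
    mem_completion_of_cauchy S ?_ ?_, ?_⟩
  · intro N
    obtain ⟨c, hc⟩ := hadvd N (2 * N) (by omega)
    obtain ⟨c', hc'⟩ := hadvd N (2 * N + 1) (by omega)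
    refine ⟨-(c • ⟨E (2 * N), hM _⟩ + c' • ⟨E (2 * N + 1), hM _⟩), ?_⟩
    simp only [S]
    rw [show 2 * (N + 1) = 2 * N + 1 + 1 by ring, Finset.sum_range_succ, Finset.sum_range_succ,
      hc, hc']
    module
  · intro N
    choose! c hc using hadvd N
    refine ⟨-PowerSeries.mk fun n =>
      ∑ i ∈ Finset.range n, c (2 * N + i) * coeff n (E (2 * N + i)), ?_⟩
    ext n
    have h1 := hsum n (2 * N + n) (by omega)
    rw [Finset.sum_range_add] at h1
    simp only [S, map_sub, coeff_mk, coeff_smul, map_neg, Submodule.coe_neg, Submodule.coe_sum,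
      Submodule.coe_smul, map_sum, smul_eq_mul]
    have h2 : ∑ i ∈ Finset.range n, a (2 * N + i) * coeff n (E (2 * N + i)) =
        (p : R) ^ N * ∑ i ∈ Finset.range n, c (2 * N + i) * coeff n (E (2 * N + i)) := by
      rw [Finset.mul_sum]
      refine Finset.sum_congr rfl fun i _ => ?_
      rw [hc (2 * N + i) (by omega), mul_assoc]
    rw [← h1, h2]
    ring
  · ext n
    rcases n with _ | n
    · simp [diff, -coeff_zero_eq_constantCoeff]
    · simp only [diff, LinearMap.coe_mk, AddHom.coe_mk, coeff_mk, map_sub, coeff_geom]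
      rw [add_comm β, add_pow, Finset.sum_range_succ' _ (n + 1), Nat.choose_zero_right]
      simp only [pow_zero, Nat.sub_zero, one_mul, Nat.cast_one, mul_one, add_sub_cancel_right]
      rw [neg_mul_neg, Finset.mul_sum]
      refine Finset.sum_congr rfl fun m _ => ?_
      simp only [ha, hE, coeff_smul, coeff_succ_X_mul_geom_pow, smul_eq_mul]
      -- This identity and `hb` match the derivative of the logarithm with the binomial expansion of
      -- `(β + pδ)^(n+1)`, term by term.
      have h1 : ((n + 1 : ℕ) : R) * n.choose m = (n + 1).choose (m + 1) * ((m + 1 : ℕ) : R) := by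
        exact_mod_cast congrArg (Nat.cast (R := R)) (Nat.add_one_mul_choose_eq n m)
      have h2 := hb (m + 1)
      rw [Nat.factorial_succ, Nat.cast_mul] at h2
      rw [mul_pow, show n + 1 - (m + 1) = n - m by omega]
      linear_combination (b (m + 1) * δ ^ (m + 1) * m.factorial * β ^ (n - m)) * h1 +
        (δ ^ (m + 1) * β ^ (n - m) * (n + 1).choose (m + 1)) * h2

/-! ### Partial fractions for the cubic -/

section Cubic

variable [Nontrivial R] (τ : R)

theorem natDegree_cubic : (Polynomial.X ^ 3 - Polynomial.X - Polynomial.C τ).natDegree = 3 := by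
  compute_degree!

theorem reverse_cubic :
    ((Polynomial.X ^ 3 - Polynomial.X - Polynomial.C τ).reverse : R⟦X⟧) =
      1 - X ^ 2 - C τ * X ^ 3 := by
  have h : (Polynomial.X ^ 3 - Polynomial.X - Polynomial.C τ).reverse =
      1 - Polynomial.X ^ 2 - Polynomial.C τ * Polynomial.X ^ 3 := by
    rw [Polynomial.reverse, natDegree_cubic, Polynomial.reflect_sub, Polynomial.reflect_sub,
      Polynomial.reflect_C]
    have h1 := Polynomial.reflect_monomial (R := R) 3 1
    have h3 := Polynomial.reflect_monomial (R := R) 3 3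
    rw [pow_one] at h1
    rw [h1, h3]
    simp [Polynomial.revAt_le]
  rw [h]
  simp

/-- The inverse of the reversed cubic. -/
def cubicInv : R⟦X⟧ :=
  invOfUnit ((Polynomial.X ^ 3 - Polynomial.X - Polynomial.C τ).reverse : R⟦X⟧) 1

theorem cubicInv_mul : cubicInv τ * (1 - X ^ 2 - C τ * X ^ 3) = 1 := by
  rw [cubicInv, mul_comm, ← reverse_cubic τ]
  apply mul_invOfUnit
  rw [reverse_cubic]
  simp

theorem expansion_cubic (k l : ℕ) :
    expansion (Polynomial.X ^ 3 - Polynomial.X - Polynomial.C τ) k l =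
      X ^ (3 * (l + 1) - k) * cubicInv τ ^ (l + 1) := by
  rw [expansion, natDegree_cubic, cubicInv]

variable {τ}

/-- Reversed form of the factorisation `x³ - x - τ = (x - β)(x² + βx + β² - 1)`. -/
theorem geom_eq_mul_cubicInv {β : R} (hβ : β ^ 3 - β = τ) :
    geom β = (1 + C β * X + C (β ^ 2 - 1) * X ^ 2) * cubicInv τ := by
  have h1 := geom_mul β
  have h2 := cubicInv_mul τ
  subst hβ
  simp only [map_sub, map_pow, map_one] at h2 ⊢
  linear_combination (1 + C β * X + (C β ^ 2 - 1) * X ^ 2) * cubicInv (β ^ 3 - β) * h1 -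
    geom β * h2

/-- With `Q` the quadratic cofactor, `1/(x - β)^(m+1) = Q^(m+1)/f^(m+1)`, and the numerator has
degree at most `2(m+1) < 3(m+1)`. The polynomial `P` is `Q^(m+1)` reversed. -/
theorem smul_X_mul_geom_pow_mem {β : R} (hβ : β ^ 3 - β = τ) (m : ℕ) :
    (m.factorial : R) • (X ^ (m + 1) * geom β ^ (m + 1)) ∈
      functions (Polynomial.X ^ 3 - Polynomial.X - Polynomial.C τ) := by
  set P : Polynomial R := (1 + Polynomial.C β * Polynomial.X +
    Polynomial.C (β ^ 2 - 1) * Polynomial.X ^ 2) ^ (m + 1) with hP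
  have hdeg : P.natDegree ≤ 2 * (m + 1) := by
    have h : (1 + Polynomial.C β * Polynomial.X +
        Polynomial.C (β ^ 2 - 1) * Polynomial.X ^ 2).natDegree ≤ 2 := by compute_degree
    rw [mul_comm]
    exact Polynomial.natDegree_pow_le_of_le (m + 1) h
  have hPc : (1 + C β * X + C (β ^ 2 - 1) * X ^ 2 : R⟦X⟧) ^ (m + 1) = (P : R⟦X⟧) := by
    simp [hP]
  have hsum : (P : R⟦X⟧) = ∑ j ∈ Finset.range (2 * (m + 1) + 1), P.coeff j • X ^ j := by
    conv_lhs => rw [P.as_sum_range' (2 * (m + 1) + 1) (by omega)]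
    rw [← Polynomial.coeToPowerSeries.ringHom_apply, map_sum]
    refine Finset.sum_congr rfl fun j _ => ?_
    rw [Polynomial.coeToPowerSeries.ringHom_apply, Polynomial.coe_monomial,
      ← mul_one (P.coeff j), ← smul_eq_mul, map_smul, smul_eq_mul, mul_one, X_pow_eq]
  rw [geom_eq_mul_cubicInv hβ, mul_pow, hPc, hsum, Finset.sum_mul, Finset.mul_sum,
    Finset.smul_sum]
  refine Submodule.sum_mem _ fun j hj => ?_
  have hj' : j ≤ 2 * (m + 1) := by simpa [Nat.lt_succ_iff] using hj
  have : (m.factorial : R) • (X ^ (m + 1) * (P.coeff j • X ^ j * cubicInv τ ^ (m + 1))) =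
      P.coeff j • ((m.factorial : R) •
        expansion (Polynomial.X ^ 3 - Polynomial.X - Polynomial.C τ) (2 * (m + 1) - j) m) := by
    rw [expansion_cubic, show 3 * (m + 1) - (2 * (m + 1) - j) = (m + 1) + j by omega, pow_add,
      smul_comm (P.coeff j)]
    congr 1
    rw [smul_mul_assoc, mul_smul_comm]
    congr 1
    ring
  rw [this]
  refine Submodule.smul_mem _ _ (Submodule.subset_span ⟨_, _, ?_, rfl⟩)
  rw [natDegree_cubic]
  omega

/-- Partial fractions of `dx / f` and `x dx / f`. -/
theorem basisForm_cubic {α c : Fin 3 → R} (hα : ∀ i, α i ^ 3 - α i = τ) (h0 : ∑ i, c i = 0)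
    (h1 : ∑ i, c i * α i = 0) (h2 : ∑ i, c i * α i ^ 2 = 1) (j : Fin 2) :
    basisForm (Polynomial.X ^ 3 - Polynomial.X - Polynomial.C τ) j =
      ∑ i, (c i * α i ^ (j : ℕ)) • geom (α i) := by
  have h3 := congrArg (C (R := R)) (hα 0)
  have h4 := congrArg (C (R := R)) (hα 1)
  have h5 := congrArg (C (R := R)) (hα 2)
  have h0' := congrArg (C (R := R)) h0
  have h1' := congrArg (C (R := R)) h1
  have h2' := congrArg (C (R := R)) h2
  simp only [Fin.sum_univ_three, map_add, map_mul, map_pow, map_zero, map_one, map_sub]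
    at h0' h1' h2' h3 h4 h5
  simp only [basisForm, expansion_cubic, Fin.sum_univ_three, geom_eq_mul_cubicInv (hα _),
    smul_eq_C_mul]
  fin_cases j
  · simp
    linear_combination (-cubicInv τ * (1 - X ^ 2)) * h0' - cubicInv τ * X * h1' -
      cubicInv τ * X ^ 2 * h2'
  · simp
    linear_combination (-cubicInv τ * (1 - X ^ 2)) * h1' - cubicInv τ * X * h2' -
      cubicInv τ * X ^ 2 * (C (c 0) * h3 + C (c 1) * h4 + C (c 2) * h5 + C τ * h0' + h1')

end Cubic

end General

/-! ### The Picard–Fuchs system -/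

section PeriodPair

variable {R : Type*} [CommRing R]

/-- The Picard–Fuchs system satisfied by the periods of `dx / f` and `x dx / f`. -/
def IsPeriodPair (F G : R⟦X⟧) : Prop :=
  2 * d⁄dX R G = -(3 * X * d⁄dX R F + 2 * F) ∧ 2 * d⁄dX R F = -(3 * (3 * X * d⁄dX R G + G))

theorem coeff_X_mul_derivative (F : R⟦X⟧) (n : ℕ) :
    coeff n (X * d⁄dX R F) = n * coeff n F := by
  rcases n with _ | n
  · simp
  · rw [coeff_succ_X_mul, coeff_derivative, mul_comm]; push_cast; rfl

theorem isPeriodPair_iff {F G : R⟦X⟧} : IsPeriodPair F G ↔ ∀ n : ℕ,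
    2 * (n + 1) * coeff (n + 1) G = -((3 * n + 2) * coeff n F) ∧
    2 * (n + 1) * coeff (n + 1) F = -(3 * (3 * n + 1) * coeff n G) := by
  have h2 : (2 : R⟦X⟧) = C 2 := (map_ofNat C 2).symm
  have h3 : (3 : R⟦X⟧) = C 3 := (map_ofNat C 3).symm
  rw [IsPeriodPair, PowerSeries.ext_iff, PowerSeries.ext_iff, ← forall_and]
  refine forall_congr' fun n => ?_
  rw [h2, h3]
  simp only [map_neg, map_add, mul_assoc, coeff_C_mul, coeff_X_mul_derivative, coeff_derivative]
  refine and_congr (Eq.congr ?_ ?_) (Eq.congr ?_ ?_) <;> ring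

theorem IsPeriodPair.map {S : Type*} [CommRing S] (φ : R →+* S) {F G : R⟦X⟧}
    (h : IsPeriodPair F G) : IsPeriodPair (PowerSeries.map φ F) (PowerSeries.map φ G) := by
  rw [isPeriodPair_iff] at h ⊢
  intro n
  constructor
  · simpa [map_ofNat] using congrArg φ (h n).1
  · simpa [map_ofNat] using congrArg φ (h n).2

theorem IsPeriodPair.neg {F G : R⟦X⟧} (h : IsPeriodPair F G) : IsPeriodPair (-F) (-G) := by
  rw [isPeriodPair_iff] at h ⊢
  intro n
  simp only [map_neg]
  exact ⟨by linear_combination -(h n).1, by linear_combination -(h n).2⟩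

theorem IsPeriodPair.sub {F G F' G' : R⟦X⟧} (h : IsPeriodPair F G) (h' : IsPeriodPair F' G') :
    IsPeriodPair (F - F') (G - G') := by
  rw [isPeriodPair_iff] at h h' ⊢
  intro n
  simp only [map_sub]
  exact ⟨by linear_combination (h n).1 - (h' n).1, by linear_combination (h n).2 - (h' n).2⟩

/-- The system is a recursion whose leading factor `2(n+1)` is nonzero in characteristic zero. -/
theorem IsPeriodPair.unique [IsDomain R] [CharZero R] {F G F' G' : R⟦X⟧} (h : IsPeriodPair F G)
    (h' : IsPeriodPair F' G') (hF : coeff 0 F = coeff 0 F') (hG : coeff 0 G = coeff 0 G') :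
    F = F' ∧ G = G' := by
  rw [isPeriodPair_iff] at h h'
  have key : ∀ n, coeff n F = coeff n F' ∧ coeff n G = coeff n G' := by
    intro n
    induction n with
    | zero => exact ⟨hF, hG⟩
    | succ n ih =>
      have hn : (2 * (n + 1) : R) ≠ 0 := by exact_mod_cast (by omega : 2 * (n + 1) ≠ 0)
      refine ⟨mul_left_cancel₀ hn ?_, mul_left_cancel₀ hn ?_⟩
      · rw [(h n).2, (h' n).2, ih.2]
      · rw [(h n).1, (h' n).1, ih.1]
  exact ⟨PowerSeries.ext fun n => (key n).1, PowerSeries.ext fun n => (key n).2⟩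

theorem derivative_root {α : R⟦X⟧} (hα : α ^ 3 - α = X) :
    d⁄dX R α * (3 * α ^ 2 - 1) = 1 := by
  have h := congrArg (d⁄dX R) hα
  simp only [map_sub, derivative_pow, derivative_X] at h
  push_cast at h
  linear_combination h

/-- For a root `α` of `x³ - x - t`, the residues of `dx / f` and `x dx / f` at `α` are `α'` and
`α α'`. -/
theorem isPeriodPair_root {α : R⟦X⟧} (hα : α ^ 3 - α = X) :
    IsPeriodPair (d⁄dX R α) (d⁄dX R α * α) := by
  have h := derivative_root hα
  set c := d⁄dX R α with hc
  have hd : d⁄dX R c = -6 * α * c ^ 3 := by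
    have h' := congrArg (d⁄dX R) h
    have h3 : (3 : R⟦X⟧) = C 3 := (map_ofNat C 3).symm
    rw [h3] at h'
    simp only [Derivation.leibniz, map_sub, derivative_pow, derivative_C,
      Derivation.map_one_eq_zero, smul_eq_mul, ← hc] at h'
    rw [← h3] at h'
    push_cast at h'
    linear_combination c * h' - d⁄dX R c * h
  have hd' : d⁄dX R (c * α) = c ^ 2 - 6 * α ^ 2 * c ^ 3 := by
    rw [Derivation.leibniz, smul_eq_mul, smul_eq_mul, hd, ← hc]; ring
  rw [IsPeriodPair, hd, hd', ← hα]
  constructor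
  · linear_combination (-2 * c ^ 2 - 2 * c * (1 + c * (3 * α ^ 2 - 1))) * h
  · linear_combination (-9 * (α ^ 3 - α) * c ^ 2 - 3 * α * c * (1 + c * (3 * α ^ 2 - 1))) * h

end PeriodPair

/-! ### Formal residues at 0, 1, -1 -/

section Residues

/-- The power series `(x³ - x) / y` in `y = x - a`, when `a³ = a`. -/
def localFactor (a : ℚ) : ℚ⟦X⟧ := C (3 * a ^ 2 - 1) + C (3 * a) * X + X ^ 2

theorem constantCoeff_localFactor_ne_zero {a : ℚ} (ha : a ^ 3 = a) :
    constantCoeff (localFactor a) ≠ 0 := by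
  simp [localFactor]
  intro h
  have h1 : a ^ 2 = 1 / 3 := by linarith
  have h2 : a = a * (1 / 3) := by rw [← h1]; linarith
  have h3 : a = 0 := by linarith
  norm_num [h3] at h

/-- Here `x³ - x = y v(y)` with `v = localFactor a` invertible, so the pole `y^(-r-1)` splits off.
-/
theorem residue_eq {a : ℚ} (ha : a ^ 3 = a) (k r : ℕ) :
    residue a k r = coeff r ((C a + X) ^ k * (localFactor a)⁻¹ ^ (r + 1)) := by
  have hinv : localFactor a * (localFactor a)⁻¹ = 1 := PowerSeries.mul_inv_cancel _ (constantCoeff_localFactor_ne_zero ha)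
  set u : LaurentSeries ℚ := HahnSeries.single (1 : ℤ) (1 : ℚ) with hu
  have hX : HahnSeries.ofPowerSeries ℤ ℚ X = u := by simp [hu]
  have hC : ∀ q : ℚ, HahnSeries.ofPowerSeries ℤ ℚ (C q) = HahnSeries.C q := by simp
  have hu0 : u ≠ 0 := by simp [hu]
  set x : LaurentSeries ℚ := HahnSeries.C a + u with hx
  have hx' : x = HahnSeries.ofPowerSeries ℤ ℚ (C a + X) := by rw [map_add, hC, hX]
  have hP : x ^ 3 - x = u * HahnSeries.ofPowerSeries ℤ ℚ (localFactor a) := by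
    rw [hx', ← hX, ← map_mul, ← map_pow, ← map_sub, localFactor]
    congr 1
    have ha' := congrArg (C (R := ℚ)) ha
    simp only [map_sub, map_mul, map_pow, map_one] at ha' ⊢
    have h3 : (C 3 : ℚ⟦X⟧) = 3 := map_ofNat C 3
    rw [h3]
    linear_combination ha'
  have hV := congrArg (HahnSeries.ofPowerSeries ℤ ℚ) hinv
  rw [map_mul, map_one] at hV
  have hV0 : HahnSeries.ofPowerSeries ℤ ℚ (localFactor a) ≠ 0 := left_ne_zero_of_mul_eq_one hV
  have key : x ^ k / (x ^ 3 - x) ^ (r + 1) = HahnSeries.single (-(r + 1 : ℤ)) (1 : ℚ) *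
      HahnSeries.ofPowerSeries ℤ ℚ ((C a + X) ^ k * (localFactor a)⁻¹ ^ (r + 1)) := by
    have hs : HahnSeries.single (-(r + 1 : ℤ)) (1 : ℚ) * u ^ (r + 1) = 1 := by
      rw [hu, HahnSeries.single_pow, HahnSeries.single_mul_single]
      simp
    rw [div_eq_iff (pow_ne_zero _ (by rw [hP]; exact mul_ne_zero hu0 hV0)), hP, map_mul, map_pow,
      map_pow, ← hx', mul_pow]
    calc x ^ k = x ^ k * 1 * 1 ^ (r + 1) := by simp
      _ = _ := by nth_rw 1 [← hs]; rw [← hV, mul_pow]; ring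
  change (x ^ k / (x ^ 3 - x) ^ (r + 1)).coeff (-1) = _
  rw [key, HahnSeries.coeff_single_mul, one_mul,
    show (-1 - -(r + 1 : ℤ)) = (r : ℤ) by ring, HahnSeries.ofPowerSeries_apply_coeff]

/-- The relations come from the vanishing of residues of exact forms, after reducing powers of `x`
by `x³ = x + (x³ - x)`. -/
theorem isPeriodPair_period {a : ℚ} (ha : a ^ 3 = a) : IsPeriodPair (period a 0) (period a 1) := by
  set v := localFactor a with hv
  set w := v⁻¹ with hw
  set x : ℚ⟦X⟧ := C a + X with hx
  have hinv : v * w = 1 := PowerSeries.mul_inv_cancel _ (constantCoeff_localFactor_ne_zero ha)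
  have h3 : (C 3 : ℚ⟦X⟧) = 3 := map_ofNat C 3
  have ha' := congrArg (C (R := ℚ)) ha
  have hv' : d⁄dX ℚ v = C (3 * a) + 2 * X := by
    simp only [hv, localFactor, map_add, derivative_C, Derivation.leibniz, derivative_X,
      derivative_pow, smul_eq_mul]
    push_cast
    ring
  have hvx : v + X * d⁄dX ℚ v = 3 * x ^ 2 - 1 := by
    rw [hv', hv, localFactor, hx]
    simp only [map_sub, map_mul, map_pow, map_one, h3]
    ring
  have hXv : X * v = x ^ 3 - x := by
    rw [hv, localFactor, hx]
    simp only [map_sub, map_mul, map_pow, map_one, h3] at ha' ⊢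
    linear_combination -ha'
  have hx' : d⁄dX ℚ x = 1 := by simp [hx]
  have hw' : d⁄dX ℚ w = -(d⁄dX ℚ v * w ^ 2) := by
    have h := congrArg (d⁄dX ℚ) hinv
    simp only [Derivation.leibniz, Derivation.map_one_eq_zero, smul_eq_mul] at h
    linear_combination w * h - d⁄dX ℚ w * hinv
  -- The residue of `d(x^j/(x³ - x)^(n+1))` is zero.
  have exact_form : ∀ j n : ℕ, (n + 1 : ℚ) * (3 * coeff (n + 1) (x ^ (j + 2) * w ^ (n + 2)) -
      coeff (n + 1) (x ^ j * w ^ (n + 2))) = j * coeff n (x ^ (j - 1) * w ^ (n + 1)) := by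
    intro j n
    have h := coeff_X_mul_derivative (x ^ j * w ^ (n + 1)) (n + 1)
    have hd : X * d⁄dX ℚ (x ^ j * w ^ (n + 1)) = (n + 1 : ℕ) • (x ^ j * w ^ (n + 1)) +
        j • (X * (x ^ (j - 1) * w ^ (n + 1))) - (n + 1) • (3 • (x ^ (j + 2) * w ^ (n + 2)) -
          x ^ j * w ^ (n + 2)) := by
      rw [Derivation.leibniz, derivative_pow, derivative_pow, hx', hw']
      simp only [nsmul_eq_mul, smul_eq_mul, Nat.add_sub_cancel]
      push_cast
      linear_combination (-(n + 1 : ℚ⟦X⟧) * x ^ j * w ^ (n + 2)) * hvx +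
        ((n + 1 : ℚ⟦X⟧) * x ^ j * w ^ (n + 1)) * hinv
    rw [hd] at h
    simp only [map_add, map_sub, map_nsmul, coeff_succ_X_mul] at h
    simp only [nsmul_eq_mul] at h
    push_cast at h
    linear_combination -h
  have shift : ∀ k n : ℕ, coeff (n + 1) (x ^ (k + 3) * w ^ (n + 2)) =
      coeff (n + 1) (x ^ (k + 1) * w ^ (n + 2)) + coeff n (x ^ k * w ^ (n + 1)) := by
    intro k n
    rw [← coeff_succ_X_mul n (x ^ k * w ^ (n + 1)), ← map_add]
    congr 1
    linear_combination (-x ^ k * w ^ (n + 2)) * hXv + X * x ^ k * w ^ (n + 1) * hinv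
  rw [isPeriodPair_iff]
  intro n
  simp only [period, coeff_mk, residue_eq ha]
  have e0 := exact_form 0 n
  have e1 := exact_form 1 n
  have e2 := exact_form 2 n
  have s0 := shift 0 n
  have s1 := shift 1 n
  have hn : (n + 1 : ℚ) ≠ 0 := by positivity
  norm_num at e0 e1 e2 s0 s1 ⊢
  rw [s0] at e1
  rw [s1] at e2
  simp only [← hv, ← hw, ← hx]
  constructor
  · linear_combination e1
  · have e0' := e0.resolve_left hn
    linear_combination 3 * e2 - 2 * (n + 1) * e0'

theorem coeff_zero_period {a : ℚ} (ha : a ^ 3 = a) (k : ℕ) :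
    coeff 0 (period a k) = a ^ k * (3 * a ^ 2 - 1)⁻¹ := by
  rw [period, coeff_mk, residue_eq ha]
  simp [localFactor]

end Residues

/-! ### The hypergeometric solutions -/

section Hypergeometric

theorem coeff_hyp_even (a b c : ℚ) (m : ℕ) : coeff (2 * m) (hyp a b c) =
    ordinaryHypergeometricCoefficient a b c m * (27 / 4) ^ m := by
  have hs : HasSubst (C (27 / 4 : ℚ) * X ^ 2 : ℚ⟦X⟧) :=
    HasSubst.of_constantCoeff_zero' (by simp)
  rw [hyp, coeff_subst' hs, finsum_eq_single _ m]
  · simp [mul_pow, ← map_pow, ← pow_mul, coeff_X_pow]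
  · intro n hn
    rw [mul_pow, ← map_pow, coeff_C_mul, ← pow_mul, coeff_X_pow, if_neg (by omega)]
    simp

theorem coeff_hyp_odd (a b c : ℚ) (m : ℕ) : coeff (2 * m + 1) (hyp a b c) = 0 := by
  have hs : HasSubst (C (27 / 4 : ℚ) * X ^ 2 : ℚ⟦X⟧) :=
    HasSubst.of_constantCoeff_zero' (by simp)
  rw [hyp, coeff_subst' hs]
  refine finsum_eq_zero_of_forall_eq_zero fun n => ?_
  rw [mul_pow, ← map_pow, coeff_C_mul, ← pow_mul, coeff_X_pow, if_neg (by omega)]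
  simp

theorem hypergeometricCoefficient_zero (a b c : ℚ) :
    ordinaryHypergeometricCoefficient a b c 0 = 1 := by
  simp [ordinaryHypergeometricCoefficient]

theorem hypergeometricCoefficient_succ (a b : ℚ) {c : ℚ} (hc : 0 < c) (m : ℕ) :
    (m + 1) * (c + m) * ordinaryHypergeometricCoefficient a b c (m + 1) =
      (a + m) * (b + m) * ordinaryHypergeometricCoefficient a b c m := by
  have h1 : c + m ≠ 0 := by positivity
  have h2 : (m + 1 : ℚ) ≠ 0 := by positivity
  have h3 : (ascPochhammer ℚ m).eval c ≠ 0 := (ascPochhammer_pos m c hc).ne'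
  have h4 : (m.factorial : ℚ) ≠ 0 := by positivity
  simp only [ordinaryHypergeometricCoefficient, ascPochhammer_succ_eval, Nat.factorial_succ]
  push_cast
  field_simp

theorem isPeriodPair_hyp_left :
    IsPeriodPair (hyp (1 / 3) (2 / 3) (1 / 2)) (-(X * hyp (2 / 3) (4 / 3) (3 / 2))) := by
  set A := ordinaryHypergeometricCoefficient (1 / 3 : ℚ) (2 / 3) (1 / 2) with hA
  set B := ordinaryHypergeometricCoefficient (2 / 3 : ℚ) (4 / 3) (3 / 2) with hB
  have hAs := hypergeometricCoefficient_succ (1 / 3) (2 / 3) (c := 1 / 2) (by norm_num)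
  have hBs := hypergeometricCoefficient_succ (2 / 3) (4 / 3) (c := 3 / 2) (by norm_num)
  rw [← hA] at hAs
  rw [← hB] at hBs
  -- Contiguity: `(4/3)_m = (3m+1)(1/3)_m` and `(3/2)_m = (2m+1)(1/2)_m`. As the two series have
  -- opposite parity, one equation of the system is trivial for each parity of `n`.
  have hAB : ∀ m : ℕ, (2 * m + 1) * B m = (3 * m + 1) * A m := by
    intro m
    induction m with
    | zero => simp [hA, hB, hypergeometricCoefficient_zero]
    | succ m ih =>
      have h : (m + 1 : ℚ) * (2 * m + 1) ≠ 0 := by positivity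
      apply mul_left_cancel₀ h
      push_cast
      linear_combination 2 * (2 * m + 1) * hBs m - 2 * (3 * (m + 1) + 1) * hAs m +
        2 * (2 / 3 + m) * (4 / 3 + m) * ih
  rw [isPeriodPair_iff]
  intro n
  obtain ⟨m, rfl | rfl⟩ := n.even_or_odd'
  · simp only [map_neg, coeff_succ_X_mul, coeff_hyp_even, coeff_hyp_odd]
    constructor
    · push_cast
      linear_combination -2 * (27 / 4) ^ m * hAB m
    · rcases m with _ | m
      · simp
      · rw [show 2 * (m + 1) = 2 * m + 1 + 1 by ring, coeff_succ_X_mul, coeff_hyp_odd]; simp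
  · rw [show 2 * m + 1 + 1 = 2 * (m + 1) by ring]
    simp only [map_neg, coeff_succ_X_mul, coeff_hyp_even, coeff_hyp_odd]
    rw [show 2 * (m + 1) = 2 * m + 1 + 1 by ring, coeff_succ_X_mul, coeff_hyp_odd]
    refine ⟨by simp, ?_⟩
    have h : (2 * m + 1 : ℚ) ≠ 0 := by positivity
    apply mul_left_cancel₀ h
    push_cast
    rw [pow_succ]
    linear_combination 54 * (27 / 4) ^ m * hAs m - 6 * (3 * m + 2) * (27 / 4) ^ m * hAB m

theorem isPeriodPair_hyp_right :
    IsPeriodPair (-(C (3 / 2 : ℚ) * X * hyp (7 / 6) (5 / 6) (3 / 2)))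
      (hyp (1 / 6) (5 / 6) (1 / 2)) := by
  set A := ordinaryHypergeometricCoefficient (1 / 6 : ℚ) (5 / 6) (1 / 2) with hA
  set B := ordinaryHypergeometricCoefficient (7 / 6 : ℚ) (5 / 6) (3 / 2) with hB
  have hAs := hypergeometricCoefficient_succ (1 / 6) (5 / 6) (c := 1 / 2) (by norm_num)
  have hBs := hypergeometricCoefficient_succ (7 / 6) (5 / 6) (c := 3 / 2) (by norm_num)
  rw [← hA] at hAs
  rw [← hB] at hBs
  -- Contiguity again, now from `(7/6)_m = (6m+1)(1/6)_m`.
  have hAB : ∀ m : ℕ, (2 * m + 1) * B m = (6 * m + 1) * A m := by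
    intro m
    induction m with
    | zero => simp [hA, hB, hypergeometricCoefficient_zero]
    | succ m ih =>
      have h : (m + 1 : ℚ) * (2 * m + 1) ≠ 0 := by positivity
      apply mul_left_cancel₀ h
      push_cast
      linear_combination 2 * (2 * m + 1) * hBs m - 2 * (6 * (m + 1) + 1) * hAs m +
        2 * (7 / 6 + m) * (5 / 6 + m) * ih
  rw [isPeriodPair_iff]
  intro n
  obtain ⟨m, rfl | rfl⟩ := n.even_or_odd'
  · simp only [map_neg, mul_assoc, coeff_C_mul, coeff_succ_X_mul, coeff_hyp_even, coeff_hyp_odd]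
    constructor
    · rcases m with _ | m
      · simp
      · rw [show 2 * (m + 1) = 2 * m + 1 + 1 by ring, coeff_succ_X_mul, coeff_hyp_odd]; simp
    · push_cast
      linear_combination -3 * (27 / 4) ^ m * hAB m
  · rw [show 2 * m + 1 + 1 = 2 * (m + 1) by ring]
    simp only [map_neg, mul_assoc, coeff_C_mul, coeff_succ_X_mul, coeff_hyp_even, coeff_hyp_odd]
    rw [show 2 * (m + 1) = 2 * m + 1 + 1 by ring, coeff_succ_X_mul, coeff_hyp_odd]
    refine ⟨?_, by simp⟩
    have h : (2 * m + 1 : ℚ) ≠ 0 := by positivity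
    apply mul_left_cancel₀ h
    push_cast
    rw [pow_succ]
    linear_combination 54 * (27 / 4) ^ m * hAs m - 3 / 2 * (6 * m + 5) * (27 / 4) ^ m * hAB m

theorem coeff_zero_hyp (a b c : ℚ) : coeff 0 (hyp a b c) = 1 := by
  simpa [hypergeometricCoefficient_zero] using coeff_hyp_even a b c 0

theorem periodMatrix_eq_hypMatrix : periodMatrix = hypMatrix := by
  have h0 : (0 : ℚ) ^ 3 = 0 := by norm_num
  have h1 : (1 : ℚ) ^ 3 = 1 := by norm_num
  have h2 : (-1 : ℚ) ^ 3 = -1 := by norm_num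
  obtain ⟨e1, e2⟩ := (isPeriodPair_period h0).neg.unique isPeriodPair_hyp_left
    (by rw [map_neg, coeff_zero_period h0, coeff_zero_hyp]; norm_num)
    (by rw [map_neg, coeff_zero_period h0]; simp)
  obtain ⟨e3, e4⟩ := ((isPeriodPair_period h1).sub (isPeriodPair_period h2)).unique
    isPeriodPair_hyp_right
    (by rw [map_sub, coeff_zero_period h1, coeff_zero_period h2]; simp)
    (by rw [map_sub, coeff_zero_period h1, coeff_zero_period h2, coeff_zero_hyp]; norm_num)
  rw [periodMatrix, hypMatrix, e1, e2, e3, e4]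

end Hypergeometric

/-! ### The basis dual to the periods, and the Cartier matrix -/

section DualForm

variable {R : Type*} [CommRing R]

/-- The forms `-dx / (x - β₀) + (dx / (x - β₁) + dx / (x - β₂)) / 2` and
`(dx / (x - β₁) - dx / (x - β₂)) / 2`, where `h = 1 / 2`. -/
def dualForm (h : R) (β : Fin 3 → R) : Fin 2 → R⟦X⟧ :=
  ![-geom (β 0) + h • (geom (β 1) + geom (β 2)), h • (geom (β 1) - geom (β 2))]

/-- The coefficients of `x ^ (-n) dx / x` in the dual forms. -/
def dualCoeff (h : R) (β : Fin 3 → R) (n : ℕ) : Fin 2 → R :=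
  ![-β 0 ^ n + h * (β 1 ^ n + β 2 ^ n), h * (β 1 ^ n - β 2 ^ n)]

theorem coeff_sum_dualForm (h : R) (β : Fin 3 → R) (ν : Fin 2 → R) (n : ℕ) :
    coeff n (∑ j, ν j • dualForm h β j) =
      ν 0 * dualCoeff h β n 0 + ν 1 * dualCoeff h β n 1 := by
  simp only [Fin.sum_univ_two, dualForm, dualCoeff, Matrix.cons_val_zero, Matrix.cons_val_one,
    Matrix.cons_val_fin_one, map_add, coeff_smul, map_neg, map_sub, coeff_geom, smul_eq_mul]

/-- A combination of the dual forms that is formally exact vanishes. -/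
theorem eq_zero_of_dualForm_exact {p : ℕ} (hR : ∀ x : R, (∀ s, (p : R) ^ s ∣ x) → x = 0) {h : R}
    {β : Fin 3 → R} (hu : ∀ s, IsUnit (dualCoeff h β (p ^ s) 0 * dualCoeff h β (p ^ s * 2) 1 -
      dualCoeff h β (p ^ s * 2) 0 * dualCoeff h β (p ^ s) 1))
    (ν : Fin 2 → R) (g : R⟦X⟧) (hg : ∑ j, ν j • dualForm h β j = diff g) : ν = 0 := by
  have key : ∀ s : ℕ, (p : R) ^ s ∣ ν 0 ∧ (p : R) ^ s ∣ ν 1 := by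
    intro s
    have hcoeff : ∀ n : ℕ, p ^ s ∣ n → (p : R) ^ s ∣
        ν 0 * dualCoeff h β n 0 + ν 1 * dualCoeff h β n 1 := by
      rintro n ⟨m, rfl⟩
      rw [← coeff_sum_dualForm, hg]
      simp only [diff, LinearMap.coe_mk, AddHom.coe_mk, coeff_mk]
      push_cast
      exact ⟨-(m * coeff (p ^ s * m) g), by ring⟩
    -- Two coefficients give a linear system for `ν` modulo `p^s` with unit determinant, solved by
    -- Cramer's rule.
    have d1 := hcoeff (p ^ s) dvd_rfl
    have d2 := hcoeff (p ^ s * 2) (dvd_mul_right _ _)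
    refine ⟨(hu s).dvd_mul_left.mp ?_, (hu s).dvd_mul_left.mp ?_⟩
    · convert (d1.mul_left (dualCoeff h β (p ^ s * 2) 1)).sub
        (d2.mul_left (dualCoeff h β (p ^ s) 1)) using 1
      ring
    · convert (d2.mul_left (dualCoeff h β (p ^ s) 0)).sub
        (d1.mul_left (dualCoeff h β (p ^ s * 2) 0)) using 1
      ring
  funext j
  fin_cases j
  · exact hR _ fun s => (key s).1
  · exact hR _ fun s => (key s).2

/-- The minus residue at the first root, and the difference of the residues at the other two, of
`dx / f` and `x dx / f`, where the residues of `dx / f` are `c`. -/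
def rootMatrix (c α : Fin 3 → R) : Matrix (Fin 2) (Fin 2) R :=
  !![-c 0, c 1 - c 2; -(c 0 * α 0), c 1 * α 1 - c 2 * α 2]

theorem rootMatrix_map {S : Type*} [CommRing S] (φ : R →+* S) (c α : Fin 3 → R) :
    (rootMatrix c α).map φ = rootMatrix (φ ∘ c) (φ ∘ α) := by
  ext i j
  fin_cases i <;> fin_cases j <;> simp [rootMatrix]

/-- The residues of each form sum to zero, so the form is recovered from `-res₀` and `res₁ - res₂`;
the dual forms are the basis dual to these two functionals. -/
theorem basisForm_eq_sum_dualForm [Nontrivial R] {τ h : R} (hh : 2 * h = 1) {α c : Fin 3 → R}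
    (hα : ∀ i, α i ^ 3 - α i = τ) (h0 : ∑ i, c i = 0) (h1 : ∑ i, c i * α i = 0)
    (h2 : ∑ i, c i * α i ^ 2 = 1) (i : Fin 2) :
    basisForm (Polynomial.X ^ 3 - Polynomial.X - Polynomial.C τ) i =
      ∑ j, rootMatrix c α i j • dualForm h α j := by
  rw [basisForm_cubic hα h0 h1 h2]
  ext n
  rw [coeff_sum_dualForm]
  simp only [Fin.sum_univ_three, map_add, coeff_smul, coeff_geom, smul_eq_mul] at h0 h1 ⊢
  fin_cases i
  · simp [rootMatrix, dualCoeff]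
    linear_combination (α 1 ^ n * h + α 2 ^ n * h) * h0 - (c 1 * α 1 ^ n + c 2 * α 2 ^ n) * hh
  · simp [rootMatrix, dualCoeff]
    linear_combination (α 1 ^ n * h + α 2 ^ n * h) * h1 -
      (c 1 * α 1 * α 1 ^ n + c 2 * α 2 * α 2 ^ n) * hh

theorem cartier_dualForm_sub_mem {p : ℕ} {N : Submodule R R⟦X⟧} (h : R) {α β : Fin 3 → R}
    (hN : ∀ i, geom (α i ^ p) - geom (β i) ∈ N) (j : Fin 2) :
    cartier p (dualForm h α j) - dualForm h β j ∈ N := by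
  have e : ∀ x y z x' y' z' : R⟦X⟧, -x + h • (y + z) - (-x' + h • (y' + z')) =
      -(x - x') + h • ((y - y') + (z - z')) := fun _ _ _ _ _ _ => by module
  have e' : ∀ y z y' z' : R⟦X⟧, h • (y - z) - h • (y' - z') =
      h • ((y - y') - (z - z')) := fun _ _ _ _ => by module
  fin_cases j
  · simp only [dualForm, Fin.zero_eta, Matrix.cons_val_zero, map_add, map_neg, map_smul,
      cartier_geom, e]
    exact N.add_mem (N.neg_mem (hN 0)) (N.smul_mem _ (N.add_mem (hN 1) (hN 2)))
  · simp only [dualForm, Fin.mk_one, Matrix.cons_val_one, Matrix.cons_val_fin_one, map_sub, map_smul,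
      cartier_geom, e']
    exact N.smul_mem _ (N.sub_mem (hN 1) (hN 2))

/-- The operator is `R`-linear, so it sends `Y e` to `Y e^σ` modulo exact forms, while `Λ ω^σ = Λ
Y^σ e^σ`. Independence of the `e^σ` modulo exact forms turns the congruence into `Y = Λ Y^σ`. -/
theorem isCartierMatrix_iff {p : ℕ} {σ : R →+* R} {f : Polynomial R} {h : R} {α β : Fin 3 → R}
    {Y Λ : Matrix (Fin 2) (Fin 2) R} (hY : ∀ i, basisForm f i = ∑ j, Y i j • dualForm h α j)
    (hYσ : ∀ i, basisForm (f.map σ) i = ∑ j, Y.map σ i j • dualForm h β j)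
    (hmem : ∀ i, geom (α i ^ p) - geom (β i) ∈ (completion p (functions (f.map σ))).map diff)
    (hunique : ∀ (ν : Fin 2 → R) (g : R⟦X⟧), ∑ j, ν j • dualForm h β j = diff g → ν = 0)
    (hdet : IsUnit (Y.map σ).det) :
    IsCartierMatrix p σ f Λ ↔ Λ = Y * (Y.map σ)⁻¹ := by
  set N := (completion p (functions (f.map σ))).map diff with hN
  have key : ∀ i, cartier p (basisForm f i) - ∑ j, Λ i j • basisForm (f.map σ) j ∈ N ↔
      ∑ j, (Y - Λ * Y.map σ) i j • dualForm h β j ∈ N := by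
    intro i
    have e : cartier p (basisForm f i) - ∑ j, Λ i j • basisForm (f.map σ) j =
        ∑ j, Y i j • (cartier p (dualForm h α j) - dualForm h β j) +
        ∑ j, (Y - Λ * Y.map σ) i j • dualForm h β j := by
      simp only [hY, hYσ, map_add, map_smul, Fin.sum_univ_two, Matrix.sub_apply, Matrix.mul_apply]
      module
    rw [e]
    exact N.add_mem_iff_right (N.sum_mem fun j _ =>
      N.smul_mem _ (cartier_dualForm_sub_mem h hmem j))
  have hzero : IsCartierMatrix p σ f Λ ↔ Y - Λ * Y.map σ = 0 := by
    rw [IsCartierMatrix, ← hN, forall_congr' key]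
    constructor
    · intro H
      ext i j
      obtain ⟨g, -, hg⟩ := H i
      exact congrFun (hunique _ g hg.symm) j
    · intro H i
      simp only [H, Matrix.zero_apply, zero_smul, Finset.sum_const_zero]
      exact N.zero_mem
  rw [hzero, sub_eq_zero]
  constructor
  · intro H
    nth_rw 1 [H]
    rw [Matrix.mul_nonsing_inv_cancel_right _ _ hdet]
  · rintro rfl
    rw [Matrix.nonsing_inv_mul_cancel_right _ _ hdet]

end DualForm

/-! ### Arithmetic over `ℤ_p⟦t⟧`: Frobenius, divided powers, roots -/

section Padic

variable {p : ℕ} [hp : Fact p.Prime]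

theorem C_dvd_iff_forall_dvd_coeff {R : Type*} [CommRing R] (r : R) (g : R⟦X⟧) :
    C r ∣ g ↔ ∀ n, r ∣ coeff n g := by
  constructor
  · rintro ⟨h, rfl⟩ n
    exact ⟨coeff n h, coeff_C_mul _ _ _⟩
  · intro h
    choose c hc using h
    exact ⟨PowerSeries.mk c, by ext n; rw [coeff_C_mul, coeff_mk, hc]⟩

theorem natCast_pow_eq_C (s : ℕ) : ((p : ℤ_[p]⟦X⟧)) ^ s = C ((p : ℤ_[p]) ^ s) := by simp

theorem eq_zero_of_forall_pow_dvd {g : ℤ_[p]⟦X⟧} (h : ∀ s : ℕ, (p : ℤ_[p]⟦X⟧) ^ s ∣ g) :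
    g = 0 := by
  ext n
  rw [map_zero, ← PadicInt.ext_of_toZModPow]
  intro s
  rw [map_zero, ← RingHom.mem_ker, PadicInt.ker_toZModPow, Ideal.mem_span_singleton]
  have := h s
  rw [natCast_pow_eq_C, C_dvd_iff_forall_dvd_coeff] at this
  exact this n

/-- The Frobenius lift is congruent to the `p`-th power modulo `p`. -/
theorem dvd_pow_sub_frob (g : ℤ_[p]⟦X⟧) : (p : ℤ_[p]⟦X⟧) ∣ g ^ p - frob p g := by
  have h1 : PowerSeries.map (PadicInt.toZMod (p := p)) (g ^ p - frob p g) = 0 := by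
    have h2 : PowerSeries.map (PadicInt.toZMod (p := p)) (frob p g) =
        PowerSeries.expand p hp.out.ne_zero (PowerSeries.map PadicInt.toZMod g) :=
      PowerSeries.map_expand p hp.out.ne_zero _ g
    have h3 : PowerSeries.map (frobenius (ZMod p) p)
        (PowerSeries.expand p hp.out.ne_zero (PowerSeries.map PadicInt.toZMod g)) =
        (PowerSeries.map PadicInt.toZMod g) ^ p :=
      MvPowerSeries.map_frobenius_expand p hp.out.ne_zero
    -- Frobenius is the identity on `𝔽_p`, so `g(t^p) = g(t)^p` in `𝔽_p⟦t⟧`.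
    rw [ZMod.frobenius_zmod, PowerSeries.map_id] at h3
    rw [map_sub, map_pow, h2, ← h3]
    simp
  have h4 := natCast_pow_eq_C (p := p) 1
  rw [pow_one, pow_one] at h4
  rw [h4, C_dvd_iff_forall_dvd_coeff]
  intro n
  have h5 := congrArg (coeff n) h1
  rw [coeff_map, map_zero, ← RingHom.mem_ker, PadicInt.ker_toZMod,
    PadicInt.maximalIdeal_eq_span_p, Ideal.mem_span_singleton] at h5
  exact h5

/-- The divided powers `p ^ m / m!`. -/
theorem exists_dividedPower (hp2 : 2 < p) (m : ℕ) :
    ∃ b : ℤ_[p], (m.factorial : ℤ_[p]) * b = (p : ℤ_[p]) ^ m ∧ (p : ℤ_[p]) ^ (m / 2) ∣ b := by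
  set v := padicValNat p m.factorial with hv
  -- Legendre: `(p - 1) v < m` for `m ≠ 0`, and `p - 1 ≥ 2`. Hence `m - v ≥ m/2`.
  have hvm : 2 * v ≤ m := by
    rcases eq_or_ne m 0 with rfl | hm
    · simp [hv]
    · have h := sub_one_mul_padicValNat_factorial_lt_of_ne_zero p hm
      rw [← hv] at h
      have : 2 * v ≤ (p - 1) * v := Nat.mul_le_mul_right _ (by omega)
      omega
  obtain ⟨w, hw⟩ : p ^ v ∣ m.factorial := pow_padicValNat_dvd
  have hwp : ¬ p ∣ w := by
    rintro ⟨x, rfl⟩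
    refine pow_succ_padicValNat_not_dvd (p := p) m.factorial_ne_zero ⟨x, ?_⟩
    rw [← hv, pow_succ, mul_assoc, ← hw]
  have hwu : IsUnit (w : ℤ_[p]) := by
    rw [PadicInt.isUnit_iff]
    refine le_antisymm (PadicInt.norm_le_one _) (not_lt.mp fun h => hwp ?_)
    have := PadicInt.norm_intCast_lt_one_iff (p := p) (z := w)
    exact_mod_cast this.mp (by exact_mod_cast h)
  obtain ⟨u, hu⟩ := hwu.exists_right_inv
  refine ⟨p ^ (m - v) * u, ?_, (pow_dvd_pow _ (by omega)).mul_right _⟩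
  rw [hw]
  push_cast
  calc (p : ℤ_[p]) ^ v * w * (p ^ (m - v) * u) = p ^ (v + (m - v)) * (w * u) := by
        rw [pow_add]; ring
    _ = p ^ m := by rw [hu, mul_one, Nat.add_sub_cancel' (by omega)]

theorem isUnit_natCast {a : ℕ} (ha0 : a ≠ 0) (ha : a < p) : IsUnit (a : ℤ_[p]) := by
  rw [PadicInt.isUnit_iff]
  refine le_antisymm (PadicInt.norm_le_one _) (not_lt.mp fun h => ?_)
  have := (PadicInt.norm_intCast_lt_one_iff (p := p) (z := a)).mp (by exact_mod_cast h)
  exact absurd (Nat.le_of_dvd (Nat.pos_of_ne_zero ha0) (by exact_mod_cast this)) (by omega)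

/-- Hensel lifting of a root of `x³ - x` to a root of `x³ - x - t`. -/
theorem exists_root {a : ℤ_[p]} (ha : a ^ 3 = a) (hu : IsUnit (3 * a ^ 2 - 1)) :
    ∃ α : ℤ_[p]⟦X⟧, α ^ 3 - α = X ∧ constantCoeff α = a := by
  obtain ⟨α, hα, hαa⟩ := HenselianRing.is_henselian (I := Ideal.span {(X : ℤ_[p]⟦X⟧)})
    (Polynomial.X ^ 3 - Polynomial.X - Polynomial.C X) (by monicity!) (C a)
    (by
      rw [Ideal.mem_span_singleton]
      simp only [Polynomial.eval_sub, Polynomial.eval_pow, Polynomial.eval_X, Polynomial.eval_C]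
      rw [← map_pow, ha, sub_self, zero_sub]
      exact (dvd_refl _).neg_right)
    (by
      refine IsUnit.map _ ?_
      have hd : Polynomial.derivative (Polynomial.X ^ 3 - Polynomial.X -
          Polynomial.C (X : ℤ_[p]⟦X⟧)) = 3 * Polynomial.X ^ 2 - 1 := by
        have h2 : Polynomial.C (2 : ℤ_[p]⟦X⟧) = 2 := map_ofNat _ 2
        simp [h2]
        norm_num
      have he : (3 * Polynomial.X ^ 2 - 1 : Polynomial ℤ_[p]⟦X⟧).eval (C a) =
          C (3 * a ^ 2 - 1) := by
        simp [map_ofNat]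
      rw [hd, he]
      exact hu.map C)
  refine ⟨α, ?_, ?_⟩
  · have h : α ^ 3 - α - X = 0 := by simpa using hα
    linear_combination h
  · rw [Ideal.mem_span_singleton, X_dvd_iff, map_sub, constantCoeff_C, sub_eq_zero] at hαa
    exact hαa

theorem constantCoeff_frob (g : ℤ_[p]⟦X⟧) : constantCoeff (frob p g) = constantCoeff g :=
  PowerSeries.constantCoeff_expand p hp.out.ne_zero g

theorem cubic_map_frob : (cubic p).map (frob p) =
    Polynomial.X ^ 3 - Polynomial.X - Polynomial.C (X ^ p) := by
  have h : frob p X = X ^ p := PowerSeries.expand_X p hp.out.ne_zero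
  simp [cubic, h]

/-- The determinant of the coefficients of the dual forms at `1 / x ^ n` and `1 / x ^ (2 n)`, for
odd `n`. -/
theorem isUnit_dualForm_det {h : ℤ_[p]⟦X⟧} (hh : 2 * h = 1) {β : Fin 3 → ℤ_[p]⟦X⟧}
    (h0 : constantCoeff (β 0) = 0) (h1 : constantCoeff (β 1) = 1)
    (h2 : constantCoeff (β 2) = -1) {n : ℕ} (hn : Odd n) :
    IsUnit (dualCoeff h β n 0 * dualCoeff h β (n * 2) 1 -
      dualCoeff h β (n * 2) 0 * dualCoeff h β n 1) := by
  have hc : 2 * constantCoeff h = 1 := by simpa [map_ofNat] using congrArg constantCoeff hh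
  have hn0 : n ≠ 0 := hn.pos.ne'
  rw [isUnit_iff_constantCoeff]
  -- At `t = 0` the roots are 0, 1, -1: the dual coefficients are `(0, 1)` at odd `n` and `(1, 0)`
  -- at `2n`, so the determinant is -1.
  convert (isUnit_one (M := ℤ_[p])).neg using 1
  simp only [dualCoeff, Matrix.cons_val_zero, Matrix.cons_val_one, Matrix.cons_val_fin_one,
    map_sub, map_mul, map_add, map_neg, map_pow, h0, h1, h2,
    zero_pow hn0, zero_pow (mul_ne_zero hn0 two_ne_zero), one_pow, hn.neg_one_pow,
    (even_two.mul_left n).neg_one_pow]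
  linear_combination (-2 * constantCoeff h - 1) * hc

/-- The derivatives of the roots of `x³ - x - t` have the power sums of the residues of
`dx / f`. -/
theorem sum_derivative_roots {α : Fin 3 → ℤ_[p]⟦X⟧} (hα : ∀ i, α i ^ 3 - α i = X)
    (hne : ∀ i j, i ≠ j → α i ≠ α j) :
    ∑ i, d⁄dX ℤ_[p] (α i) = 0 ∧ ∑ i, d⁄dX ℤ_[p] (α i) * α i = 0 ∧
      ∑ i, d⁄dX ℤ_[p] (α i) * α i ^ 2 = 1 := by
  simp only [Fin.sum_univ_three]
  -- Cancelling `α i - α j` leads to the first two power sums of the roots; differentiating them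
  -- gives the first two claims. The third is the sum over the roots of `α'(3α² - 1) = 1`.
  have hq : ∀ i j, i ≠ j → α i ^ 2 + α i * α j + α j ^ 2 = 1 := by
    intro i j hij
    apply mul_left_cancel₀ (sub_ne_zero.mpr (hne i j hij))
    linear_combination hα i - hα j
  have e1 : α 0 + α 1 + α 2 = 0 := by
    apply mul_left_cancel₀ (sub_ne_zero.mpr (hne 1 2 (by decide)))
    linear_combination hq 0 1 (by decide) - hq 0 2 (by decide)
  have e2 : α 0 ^ 2 + α 1 ^ 2 + α 2 ^ 2 = 2 := by
    linear_combination 2 * hq 0 1 (by decide) + (α 2 - α 0 - α 1) * e1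
  have d1 : d⁄dX ℤ_[p] (α 0) + d⁄dX ℤ_[p] (α 1) + d⁄dX ℤ_[p] (α 2) = 0 := by
    simpa using congrArg (d⁄dX ℤ_[p]) e1
  have h2 : (2 : ℤ_[p]⟦X⟧) = C 2 := (map_ofNat C 2).symm
  have h3 : (3 : ℤ_[p]⟦X⟧) = C 3 := (map_ofNat C 3).symm
  have h20 : (2 : ℤ_[p]⟦X⟧) ≠ 0 := by
    rw [h2, Ne, map_eq_zero_iff C C_injective]; exact two_ne_zero
  have h30 : (3 : ℤ_[p]⟦X⟧) ≠ 0 := by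
    rw [h3, Ne, map_eq_zero_iff C C_injective]; norm_num
  refine ⟨d1, ?_, ?_⟩
  · have h := congrArg (d⁄dX ℤ_[p]) e2
    rw [h2] at h
    simp only [map_add, derivative_pow, derivative_C] at h
    apply mul_left_cancel₀ h20
    push_cast at h
    linear_combination h
  · apply mul_left_cancel₀ h30
    linear_combination derivative_root (hα 0) + derivative_root (hα 1) +
      derivative_root (hα 2) + d1

theorem exists_roots (hp3 : 3 < p) : ∃ α : Fin 3 → ℤ_[p]⟦X⟧, (∀ i, α i ^ 3 - α i = X) ∧
    constantCoeff (α 0) = 0 ∧ constantCoeff (α 1) = 1 ∧ constantCoeff (α 2) = -1 := by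
  have h2 : IsUnit (2 : ℤ_[p]) := by exact_mod_cast isUnit_natCast (p := p) two_ne_zero (by omega)
  obtain ⟨α₀, h0, h0'⟩ := exists_root (p := p) (a := 0) (by simp) (by simp)
  obtain ⟨α₁, h1, h1'⟩ := exists_root (p := p) (a := 1) (by simp) (by convert h2 using 1; norm_num)
  obtain ⟨α₂, h2, h2'⟩ := exists_root (p := p) (a := -1) (by ring) (by convert h2 using 1; norm_num)
  refine ⟨![α₀, α₁, α₂], fun i => ?_, h0', h1', h2'⟩
  fin_cases i
  exacts [h0, h1, h2]

/-- At `t = 0` the residues of `dx/f` at 0, 1, -1 are -1, 1/2, 1/2. This supplies both the initial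
values of the periods and the invertibility of `Y`. -/
theorem constantCoeff_rootMatrix {α : Fin 3 → ℤ_[p]⟦X⟧} (hα : ∀ i, α i ^ 3 - α i = X)
    (h0 : constantCoeff (α 0) = 0) (h1 : constantCoeff (α 1) = 1)
    (h2 : constantCoeff (α 2) = -1) :
    (rootMatrix (fun i => d⁄dX ℤ_[p] (α i)) α).map constantCoeff = 1 := by
  have hc : ∀ i, constantCoeff (d⁄dX ℤ_[p] (α i)) * (3 * constantCoeff (α i) ^ 2 - 1) = 1 := by
    intro i
    have h3 : (constantCoeff (R := ℤ_[p])) 3 = 3 := map_ofNat _ 3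
    have h := congrArg constantCoeff (derivative_root (hα i))
    simpa only [map_mul, map_sub, map_pow, map_one, h3] using h
  have c0 := hc 0
  have c1 := hc 1
  have c2 := hc 2
  rw [h0] at c0
  rw [h1] at c1
  rw [h2] at c2
  rw [rootMatrix_map]
  ext1 i j
  fin_cases i <;> fin_cases j <;>
    simp only [rootMatrix, Function.comp_apply, h0, h1, h2, Matrix.of_apply, Matrix.cons_val',
      Matrix.cons_val_zero, Matrix.cons_val_one, Matrix.cons_val_fin_one, Fin.zero_eta, Fin.mk_one,
      Matrix.one_apply_eq, Matrix.one_apply_ne, ne_eq, zero_ne_one, one_ne_zero, not_false_eq_true]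
  · linear_combination c0
  · apply mul_left_cancel₀ (two_ne_zero (α := ℤ_[p]))
    linear_combination c1 - c2
  · ring
  · apply mul_left_cancel₀ (two_ne_zero (α := ℤ_[p]))
    linear_combination c1 + c2

/-- The matrix of residues at the roots is the hypergeometric matrix. -/
theorem rootMatrix_map_eq_hypMatrix {α : Fin 3 → ℤ_[p]⟦X⟧} (hα : ∀ i, α i ^ 3 - α i = X)
    (h0 : constantCoeff (α 0) = 0) (h1 : constantCoeff (α 1) = 1)
    (h2 : constantCoeff (α 2) = -1) :
    (rootMatrix (fun i => d⁄dX ℤ_[p] (α i)) α).map (PowerSeries.map (algebraMap ℤ_[p] ℚ_[p])) =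
      hypMatrix.map (PowerSeries.map (algebraMap ℚ ℚ_[p])) := by
  have hY := constantCoeff_rootMatrix hα h0 h1 h2
  have y00 : constantCoeff (-d⁄dX ℤ_[p] (α 0)) = 1 := congrFun (congrFun hY 0) 0
  have y01 : constantCoeff (d⁄dX ℤ_[p] (α 1) - d⁄dX ℤ_[p] (α 2)) = 0 :=
    congrFun (congrFun hY 0) 1
  have y10 : constantCoeff (-(d⁄dX ℤ_[p] (α 0) * α 0)) = 0 := congrFun (congrFun hY 1) 0
  have y11 : constantCoeff (d⁄dX ℤ_[p] (α 1) * α 1 - d⁄dX ℤ_[p] (α 2) * α 2) = 1 :=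
    congrFun (congrFun hY 1) 1
  have hy : ∀ a b c, constantCoeff (hyp a b c) = 1 := fun a b c => by
    rw [← coeff_zero_eq_constantCoeff_apply, coeff_zero_hyp]
  -- Series over `ℤ_p` and over `ℚ` are compared in `ℚ_p⟦t⟧`, where the system still has unique
  -- solutions.
  obtain ⟨e1, e2⟩ := ((isPeriodPair_root (hα 0)).neg.map (algebraMap ℤ_[p] ℚ_[p])).unique
    (isPeriodPair_hyp_left.map (algebraMap ℚ ℚ_[p]))
    (by
      simp only [coeff_map, coeff_zero_eq_constantCoeff_apply]
      rw [y00, hy, map_one, map_one])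
    (by
      simp only [coeff_map, coeff_zero_eq_constantCoeff_apply]
      rw [y10]
      simp)
  obtain ⟨e3, e4⟩ := (((isPeriodPair_root (hα 1)).sub (isPeriodPair_root (hα 2))).map
    (algebraMap ℤ_[p] ℚ_[p])).unique (isPeriodPair_hyp_right.map (algebraMap ℚ ℚ_[p]))
    (by
      simp only [coeff_map, coeff_zero_eq_constantCoeff_apply]
      rw [y01]
      simp)
    (by
      simp only [coeff_map, coeff_zero_eq_constantCoeff_apply]
      rw [y11, hy, map_one, map_one])
  ext1 i j
  fin_cases i <;> fin_cases j
  exacts [e1, e3, e2, e4]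

/-- `frob p α` is a root of `f^σ` and is congruent to `α^p` modulo `p`, so the logarithm argument
applies with `β = frob p α`. -/
theorem geom_pow_sub_geom_frob_mem (hp2 : 2 < p) {α : ℤ_[p]⟦X⟧} (hα : α ^ 3 - α = X) :
    geom (α ^ p) - geom (frob p α) ∈
      (completion p (functions ((cubic p).map (frob p)))).map diff := by
  obtain ⟨δ, hδ⟩ := dvd_pow_sub_frob α
  choose b hb hdvd using exists_dividedPower (p := p) hp2
  have hX : frob p X = X ^ p := PowerSeries.expand_X p hp.out.ne_zero
  have hβ : frob p α ^ 3 - frob p α = X ^ p := by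
    rw [← hX, ← hα, map_sub, map_pow]
  rw [cubic_map_frob, show α ^ p = frob p α + p * δ by linear_combination hδ]
  exact geom_sub_geom_mem (b := fun m => C (b m))
    (fun m => by simpa using congrArg (C (R := ℤ_[p])) (hb m))
    (fun m => by simpa using map_dvd (C (R := ℤ_[p])) (hdvd m))
    (smul_X_mul_geom_pow_mem hβ)

end Padic

end CartierCubic

end

/-! ### The main theorem -/

theorem mainTheorem3 (p : ℕ) [Fact p.Prime] (hp : 3 < p) :
    CartierCubic.periodMatrix = CartierCubic.hypMatrix ∧
    ∃ Y : Matrix (Fin 2) (Fin 2) (PowerSeries ℤ_[p]),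
      Y.map (PowerSeries.map (algebraMap ℤ_[p] ℚ_[p])) =
        CartierCubic.hypMatrix.map (PowerSeries.map (algebraMap ℚ ℚ_[p])) ∧
      IsUnit (Y.map (CartierCubic.frob p)).det ∧
      ∀ Λ : Matrix (Fin 2) (Fin 2) (PowerSeries ℤ_[p]),
        CartierCubic.IsCartierMatrix p (CartierCubic.frob p) (CartierCubic.cubic p) Λ ↔
          Λ = Y * (Y.map (CartierCubic.frob p))⁻¹ := by
  open CartierCubic in
  obtain ⟨α, hα, h0, h1, h2⟩ := exists_roots (p := p) hp
  have hne : ∀ i j, i ≠ j → α i ≠ α j := by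
    have h01 : α 0 ≠ α 1 := fun h => by
      have := congrArg PowerSeries.constantCoeff h
      rw [h0, h1] at this
      exact zero_ne_one this
    have h02 : α 0 ≠ α 2 := fun h => by
      have := congrArg PowerSeries.constantCoeff h
      rw [h0, h2] at this
      exact one_ne_zero (by linear_combination this : (1 : ℤ_[p]) = 0)
    have h12 : α 1 ≠ α 2 := fun h => by
      have := congrArg PowerSeries.constantCoeff h
      rw [h1, h2] at this
      exact two_ne_zero (by linear_combination this : (2 : ℤ_[p]) = 0)
    intro i j hij
    fin_cases i <;> fin_cases j
    exacts [absurd rfl hij, h01, h02, h01.symm, absurd rfl hij, h12, h02.symm, h12.symm,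
      absurd rfl hij]
  obtain ⟨c0, c1, c2⟩ := sum_derivative_roots hα hne
  set c : Fin 3 → PowerSeries ℤ_[p] := fun i => PowerSeries.derivative ℤ_[p] (α i) with hc
  have hY1 : (rootMatrix c α).map PowerSeries.constantCoeff = 1 :=
    constantCoeff_rootMatrix hα h0 h1 h2
  have hdet : IsUnit ((rootMatrix c α).map (frob p)).det := by
    have h : IsUnit (rootMatrix c α).det := by
      rw [PowerSeries.isUnit_iff_constantCoeff, RingHom.map_det]
      exact (congrArg (fun M => IsUnit M.det) hY1).mpr (by simp)
    have h' := h.map (frob p)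
    rwa [RingHom.map_det] at h'
  have hu2 : IsUnit (2 : ℤ_[p]) := by exact_mod_cast isUnit_natCast (p := p) two_ne_zero (by omega)
  obtain ⟨x, hx⟩ := hu2.exists_right_inv
  have hh : 2 * (PowerSeries.C x : PowerSeries ℤ_[p]) = 1 := by
    rw [← map_one PowerSeries.C, ← hx, map_mul, map_ofNat]
  refine ⟨periodMatrix_eq_hypMatrix, rootMatrix c α, rootMatrix_map_eq_hypMatrix hα h0 h1 h2, hdet,
    fun Λ => isCartierMatrix_iff (h := PowerSeries.C x) (α := α) (β := frob p ∘ α)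
      (basisForm_eq_sum_dualForm hh hα c0 c1 c2) ?_
      (fun i => geom_pow_sub_geom_frob_mem (by omega) (hα i)) ?_ hdet⟩
  · rw [rootMatrix_map, cubic_map_frob]
    refine basisForm_eq_sum_dualForm hh (fun i => ?_) ?_ ?_ ?_
    · have hX : frob p PowerSeries.X = PowerSeries.X ^ p :=
        PowerSeries.expand_X p (Fact.out : p.Prime).ne_zero
      rw [← hX, ← hα i, map_sub, map_pow]
      rfl
    · simpa using congrArg (frob p) c0
    · simpa using congrArg (frob p) c1
    · simpa using congrArg (frob p) c2
  · have hodd : Odd p := (Fact.out : p.Prime).odd_of_ne_two (by omega)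
    refine eq_zero_of_dualForm_exact (fun x => eq_zero_of_forall_pow_dvd) fun s =>
      isUnit_dualForm_det hh ?_ ?_ ?_ hodd.pow
    · exact (constantCoeff_frob _).trans h0
    · exact (constantCoeff_frob _).trans h1
    · exact (constantCoeff_frob _).trans h2
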